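/- **Setting.** A *modulus* is a continuous, non-decreasing, subadditive function $\Delta\colon[0,\infty)\to[0,\infty)$ with $\Delta(0)=0$. A *metric signature* $\sigma$ consists of predicate, function and constant symbols, where each predicate and function symbol $s$ has an arity and a modulus $\Delta_s$. A *$\sigma$-structure* $\mathfrak A$ is a non-empty complete metric space of diameter at most $1$ with an interpretation $P^{\mathfrak A}\colon\mathfrak A^{n}\to[0,1]$ of each $n$-ary predicate symbol $P$ and $f^{\mathfrak A}\colon\mathfrak A^{n}\to\mathfrak A$ of each $n$-ary function symbol $f$, respecting the respective moduli for the maximum metric on $\mathfrak A^n$ (that is, $d(s^{\mathfrak A}(\bar x),s^{\mathfrak A}(\bar y))\le\Delta_s(\max_i d(x_i,y_i))$), and an element $c^{\mathfrak A}\in\mathfrak A$ for each constant symbol $c$. Terms, in the variables $v_0,v_1,\dots$, are as in first-order logic; atomic formulae are $d(t,t')$ and $P(t_0,\dots,t_{n-1})$ for terms $t,t',t_i$. A *connective* is a continuous function $u\colon[0,1]^k\to[0,1]$, $k<\omega$, and a *basic formula* is one of the form $u(\psi_0,\dots,\psi_{k-1})$ with $u$ a connective and all $\psi_i$ atomic.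 A *weak modulus* is a function $\Omega\colon[0,\infty)^\omega\to[0,\infty]$ that is non-decreasing, subadditive, lower semicontinuous in the product topology, separately continuous in each argument, and vanishes at zero. Put $\Omega|_n(x_0,\dots,x_{n-1})=\Omega(x_0,\dots,x_{n-1},0,0,\dots)$. A formula $\varphi(v_0,\dots,v_{n-1})$ *respects* $\Omega|_n$ if in every $\sigma$-structure $\mathfrak A$, $|\varphi^{\mathfrak A}(\bar a)-\varphi^{\mathfrak A}(\bar a')|\le\Omega|_n(d(a_0,a_0'),\dots,d(a_{n-1},a_{n-1}'))$ for all $\bar a,\bar a'\in\mathfrak A^n$. The *$n$-ary $\Omega$-formulae* ($n<\omega$) are generated as follows: 1. every basic formula $\varphi(v_0,\dots,v_{n-1})$ that respects $\Omega|_n$ is an $n$-ary $\Omega$-formula; 2. if $\varphi$ is an $(n+1)$-ary $\Omega$-formula, then $\sup_{v_n}\varphi$ and $\inf_{v_n}\varphi$ are $n$-ary $\Omega$-formulae; 3. if $(\varphi_i)_{i\in I}$ is a family of $n$-ary $\Omega$-formulae indexed by an arbitrary set $I$, then $\sup_{i\in I}\varphi_i$ and $\inf_{i\in I}\varphi_i$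 are $n$-ary $\Omega$-formulae; 4. if $\varphi_0,\dots,\varphi_{k-1}$ are $n$-ary $\Omega$-formulae and $u\colon[0,1]^k\to[0,1]$ is $1$-Lipschitz for the maximum metric, then $u(\varphi_0,\dots,\varphi_{k-1})$ is an $n$-ary $\Omega$-formula. Formulae are interpreted in the obvious way, suprema and infima being taken in $[0,1]$. An *$\Omega$-sentence* is an $\Omega$-formula (of any arity) without free variables. Quantifier rank counts the nesting of $\sup_{v_n}$ and $\inf_{v_n}$ (an ordinal; connectives and infinitary suprema and infima take the supremum of the ranks of their constituents). Write $\mathfrak A\equiv^\Omega_\alpha\mathfrak B$ if $\varphi^{\mathfrak A}=\varphi^{\mathfrak B}$ for all $\Omega$-sentences $\varphi$ of quantifier rank $\le\alpha$, and $\mathfrak A\equiv^\Omega_\infty\mathfrak B$ if $\mathfrak A\equiv^\Omega_\alpha\mathfrak B$ for all ordinals $\alpha$. In the *game* $\mathrm{EF}^{\Omega}_\omega(\mathfrak A,\mathfrak B)$, where the domains of $\mathfrak A$ and $\mathfrak B$ are taken to be disjoint, player I first plays some real $\varepsilon>0$. In each round $i<\omega$ (starting together with the choice of $\varepsilon$),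 I chooses $x_i\in\mathfrak A\cup\mathfrak B$ and II responds with $y_i\in\mathfrak A\cup\mathfrak B$ such that $x_i\in\mathfrak A$ if and only if $y_i\in\mathfrak B$. Let $a_i$ be the one of $x_i,y_i$ in $\mathfrak A$ and $b_i$ the one in $\mathfrak B$. After $\omega$ rounds, II wins if for all $k<\omega$ and all basic $k$-ary $\Omega$-formulae $\varphi(v_0,\dots,v_{k-1})$, i.e. basic formulae respecting $\Omega|_k$, $$|\varphi^{\mathfrak A}(a_0,\dots,a_{k-1})-\varphi^{\mathfrak B}(b_0,\dots,b_{k-1})|\le\varepsilon .$$ **Corollary.** Let $\sigma$ be a metric signature, $\Omega$ a weak modulus, and $\mathfrak A,\mathfrak B$ two $\sigma$-structures. Then player II has a winning strategy in $\mathrm{EF}^{\Omega}_\omega(\mathfrak A,\mathfrak B)$ if and only if $\mathfrak A\equiv^\Omega_\infty\mathfrak B$. -/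

import Mathlib

open scoped NNReal ENNReal

universe u

namespace ContLogic

/-! ### Moduli -/

/-- A (unary) modulus of uniform continuity: a continuous, non-decreasing, subadditive function
`[0,∞) → [0,∞)` vanishing at zero. -/
structure Modulus where
  toFun : ℝ≥0 → ℝ≥0
  map_zero : toFun 0 = 0
  mono : Monotone toFun
  subadd : ∀ x y, toFun (x + y) ≤ toFun x + toFun y
  cont : Continuous toFun

/-- A weak modulus: a function `[0,∞)^ω → [0,∞]` that is non-decreasing, subadditive, lower
semicontinuous for the product topology, separately continuous in each argument, and vanishes at
zero. -/
structure WeakModulus where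
  toFun : (ℕ → ℝ≥0) → ℝ≥0∞
  map_zero : toFun 0 = 0
  mono : Monotone toFun
  subadd : ∀ x y, toFun (x + y) ≤ toFun x + toFun y
  lsc : LowerSemicontinuous toFun
  sepCont : ∀ (x : ℕ → ℝ≥0) (i : ℕ), Continuous fun t : ℝ≥0 => toFun (Function.update x i t)

/-- The truncation `Ω|ₙ (x₀, …, xₙ₋₁) = Ω (x₀, …, xₙ₋₁, 0, 0, …)`; here it is applied to a whole
sequence, of which only the first `n` entries are used. -/
def WeakModulus.trunc (Ω : WeakModulus) (n : ℕ) (x : ℕ → ℝ≥0) : ℝ≥0∞ :=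
  Ω.toFun fun i => if i < n then x i else 0

/-! ### Signatures and metric structures -/

/-- A metric signature, with all predicates bounded by `[0,1]` and structures of diameter at
most `1`. -/
structure Signature where
  Pred : Type u
  Func : Type u
  Const : Type u
  predArity : Pred → ℕ
  funcArity : Func → ℕ
  predMod : Pred → Modulus
  funcMod : Func → Modulus

/-- A `σ`-structure: a non-empty complete metric space of diameter at most `1` with
interpretations of the symbols. Finite powers carry the maximum metric. -/
structure MetricStructure (σ : Signature.{u}) where
  carrier : Type u
  [metric : MetricSpace carrier]
  [complete : CompleteSpace carrier]
  [nonempty : Nonempty carrier]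
  dist_le_one : ∀ x y : carrier, dist x y ≤ 1
  predInt : (P : σ.Pred) → (Fin (σ.predArity P) → carrier) → unitInterval
  predInt_mod : ∀ (P : σ.Pred) (x y : Fin (σ.predArity P) → carrier),
    nndist (predInt P x) (predInt P y) ≤ (σ.predMod P).toFun (nndist x y)
  funcInt : (f : σ.Func) → (Fin (σ.funcArity f) → carrier) → carrier
  funcInt_mod : ∀ (f : σ.Func) (x y : Fin (σ.funcArity f) → carrier),
    nndist (funcInt f x) (funcInt f y) ≤ (σ.funcMod f).toFun (nndist x y)
  constInt : σ.Const → carrier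

attribute [instance] MetricStructure.metric MetricStructure.complete MetricStructure.nonempty

instance (σ : Signature.{u}) : CoeSort (MetricStructure σ) (Type u) :=
  ⟨MetricStructure.carrier⟩

/-! ### Terms and formulae -/

/-- Terms over the variable symbols `v₀, v₁, …`. -/
inductive Term (σ : Signature.{u}) : Type u
  | var (i : ℕ) : Term σ
  | const (c : σ.Const) : Term σ
  | app (f : σ.Func) (ts : Fin (σ.funcArity f) → Term σ) : Term σ

/-- An `n`-ary connective: a continuous function `[0,1]ⁿ → [0,1]`. -/
abbrev Connective (n : ℕ) := C(Fin n → unitInterval, unitInterval)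

/-- Formulae of infinitary continuous logic, with suprema and infima over arbitrary sets of
formulae. -/
inductive Formula (σ : Signature.{u}) : Type (u + 1)
  | distAtom (t t' : Term σ) : Formula σ
  | pred (P : σ.Pred) (ts : Fin (σ.predArity P) → Term σ) : Formula σ
  | conn {k : ℕ} (c : Connective k) (φ : Fin k → Formula σ) : Formula σ
  | supVar (i : ℕ) (φ : Formula σ) : Formula σ
  | infVar (i : ℕ) (φ : Formula σ) : Formula σ
  | supFam {ι : Type u} (φ : ι → Formula σ) : Formula σ
  | infFam {ι : Type u} (φ : ι → Formula σ) : Formula σ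

variable {σ : Signature.{u}}

/-- The variables occurring in a term. -/
def Term.vars : Term σ → Set ℕ
  | .var i => {i}
  | .const _ => ∅
  | .app _ ts => ⋃ j, (ts j).vars

namespace Formula

/-- Free variables. -/
def freeVars : Formula σ → Set ℕ
  | distAtom t t' => t.vars ∪ t'.vars
  | pred _ ts => ⋃ j, (ts j).vars
  | conn _ φ => ⋃ j, (φ j).freeVars
  | supVar i φ => φ.freeVars \ {i}
  | infVar i φ => φ.freeVars \ {i}
  | supFam φ => ⋃ j, (φ j).freeVars
  | infFam φ => ⋃ j, (φ j).freeVars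

/-- Quantifier rank. Only quantification over elements counts, and connectives and infinitary
suprema and infima take the supremum of the ranks of their constituents. -/
noncomputable def qr : Formula σ → Ordinal.{u}
  | distAtom _ _ => 0
  | pred _ _ => 0
  | conn _ φ => ⨆ j, (φ j).qr
  | supVar _ φ => φ.qr + 1
  | infVar _ φ => φ.qr + 1
  | supFam φ => ⨆ j, (φ j).qr
  | infFam φ => ⨆ j, (φ j).qr

/-- Atomic formulae: `d(t,t')` and `P(t₀, …, tₙ₋₁)`. -/
def IsAtomic : Formula σ → Prop
  | distAtom _ _ => True
  | pred _ _ => True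
  | _ => False

/-- Basic formulae: a (finitary, continuous) connective applied to atomic formulae. -/
def IsBasic (φ : Formula σ) : Prop :=
  ∃ (k : ℕ) (c : Connective k) (ψ : Fin k → Formula σ), (∀ j, (ψ j).IsAtomic) ∧ φ = conn c ψ

end Formula

/-- Interpretation of a term under an assignment of the variables. -/
def Term.eval (A : MetricStructure σ) (s : ℕ → A) : Term σ → A
  | .var i => s i
  | .const c => A.constInt c
  | .app f ts => A.funcInt f fun j => (ts j).eval A s

namespace Formula

/-- Interpretation of a formula under an assignment of the variables, with values in `[0,1]`.
Suprema and infima are taken in the complete lattice `[0,1]`. -/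
noncomputable def eval (A : MetricStructure σ) : Formula σ → (ℕ → A) → unitInterval
  | distAtom t t', s => ⟨dist (t.eval A s) (t'.eval A s), dist_nonneg, A.dist_le_one _ _⟩
  | pred P ts, s => A.predInt P fun j => (ts j).eval A s
  | conn c φ, s => c fun j => (φ j).eval A s
  | supVar i φ, s => ⨆ a : A, φ.eval A (Function.update s i a)
  | infVar i φ, s => ⨅ a : A, φ.eval A (Function.update s i a)
  | supFam φ, s => ⨆ j, (φ j).eval A s
  | infFam φ, s => ⨅ j, (φ j).eval A s

/-- `φ(v₀, …, vₙ₋₁)` respects `Ω|ₙ` in every structure. -/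
def Respects (Ω : WeakModulus) (n : ℕ) (φ : Formula σ) : Prop :=
  ∀ (A : MetricStructure σ) (s t : ℕ → A),
    edist (φ.eval A s) (φ.eval A t) ≤ Ω.trunc n fun i => nndist (s i) (t i)

/-- Basic `n`-ary `Ω`-formulae: basic formulae whose free variables are among `v₀, …, vₙ₋₁` and
that respect `Ω|ₙ`. -/
def IsBasicOmega (Ω : WeakModulus) (n : ℕ) (φ : Formula σ) : Prop :=
  φ.IsBasic ∧ φ.freeVars ⊆ Set.Iio n ∧ φ.Respects Ω n

/-- `IsOmega Ω n φ`: `φ` is an `n`-ary `Ω`-formula. -/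
inductive IsOmega (Ω : WeakModulus) : ℕ → Formula σ → Prop
  | basic {n : ℕ} {φ : Formula σ} : φ.IsBasicOmega Ω n → IsOmega Ω n φ
  | supVar {n : ℕ} {φ : Formula σ} : IsOmega Ω (n + 1) φ → IsOmega Ω n (supVar n φ)
  | infVar {n : ℕ} {φ : Formula σ} : IsOmega Ω (n + 1) φ → IsOmega Ω n (infVar n φ)
  | supFam {n : ℕ} {ι : Type u} {φ : ι → Formula σ} :
      (∀ j, IsOmega Ω n (φ j)) → IsOmega Ω n (supFam φ)
  | infFam {n : ℕ} {ι : Type u} {φ : ι → Formula σ} :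
      (∀ j, IsOmega Ω n (φ j)) → IsOmega Ω n (infFam φ)
  | conn {n k : ℕ} {c : Connective k} {φ : Fin k → Formula σ} :
      LipschitzWith 1 c → (∀ j, IsOmega Ω n (φ j)) → IsOmega Ω n (conn c φ)

/-- `Ω`-sentences: `Ω`-formulae (of some arity) without free variables. -/
def IsOmegaSentence (Ω : WeakModulus) (φ : Formula σ) : Prop :=
  (∃ n, IsOmega Ω n φ) ∧ φ.freeVars = ∅

end Formula

/-- `A ≡^Ω_α B`: all `Ω`-sentences of quantifier rank at most `α` have the same value in `A` and
in `B`. (The value of a sentence does not depend on the assignment.) -/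
def OmegaEquiv (Ω : WeakModulus) (α : Ordinal.{u}) (A B : MetricStructure σ) : Prop :=
  ∀ φ : Formula σ, φ.IsOmegaSentence Ω → φ.qr ≤ α →
    ∀ (s : ℕ → A) (t : ℕ → B), φ.eval A s = φ.eval B t

/-- `A ≡^Ω_∞ B`. -/
def OmegaEquivInf (Ω : WeakModulus) (A B : MetricStructure σ) : Prop :=
  ∀ α : Ordinal.{u}, OmegaEquiv Ω α A B

/-! ### The game of length `ω`

A move is an element of the disjoint union `A ⊕ B`. -/

/-- The moves `x` of player I and `y` of player II in one round are in different structures, `a`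
being the one in `A` and `b` the one in `B`. -/
def RoundResult {A B : Type u} (x y : A ⊕ B) (a : A) (b : B) : Prop :=
  (x = Sum.inl a ∧ y = Sum.inr b) ∨ (x = Sum.inr b ∧ y = Sum.inl a)

/-- Player II wins the infinite play with moves `x` of I and `y` of II in the `(ε,Ω)`-game: all
her moves are legal, and the resulting sequences `a` and `b` satisfy every basic `k`-ary
`Ω`-formula, for every `k`, up to an error of `ε`. -/
def IIWinsPlay (Ω : WeakModulus) (A B : MetricStructure σ) (ε : ℝ) (x y : ℕ → A ⊕ B) : Prop :=
  ∃ (a : ℕ → A) (b : ℕ → B), (∀ i, RoundResult (x i) (y i) (a i) (b i)) ∧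
    ∀ (k : ℕ) (φ : Formula σ), φ.IsBasicOmega Ω k →
      |(φ.eval A a : ℝ) - (φ.eval B b : ℝ)| ≤ ε

/-- A strategy of player II: her move in round `i`, given the number `ε` that I has chosen in the
first round and the moves of I in the rounds `0, …, i`. -/
abbrev IIStrategy (A B : Type u) := ℝ → (i : ℕ) → (Fin (i + 1) → A ⊕ B) → A ⊕ B

/-- Player II has a winning strategy in the `Ω`-game of length `ω` between `A` and `B`: one with
which she wins every play, whatever `ε > 0` and whatever moves I chooses. -/
def IIWinsEF (Ω : WeakModulus) (A B : MetricStructure σ) : Prop :=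
  ∃ τ : IIStrategy A B, ∀ ε : ℝ, 0 < ε → ∀ x : ℕ → A ⊕ B,
    IIWinsPlay Ω A B ε x fun i => τ ε i fun j => x j

end ContLogic

namespace ContLogic

variable {σ : Signature.{u}}

/-! ### Free variables -/

/-! From strategies to equivalence: fix `ε` and a strategy winning every play. At any position it
reaches after `n` rounds, all `n`-ary `Ω`-formulae agree up to `ε`
(`Formula.IsOmega.abs_eval_sub_eval_le`), by induction on formulae. Basic formulae are controlled by
the winning condition, a quantifier is matched by one more move of I, and lattice operations and
1-Lipschitz connectives do not enlarge the error. A sentence does not see the position, so `ε → 0`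
gives equality.

From equivalence to strategies: II keeps all `n`-ary `Ω`-formulae within `ε(1 - 2⁻ⁿ)` after round
`n`. Initially this is the hypothesis, 0-ary `Ω`-formulae being sentences. Suppose I plays `c ∈ A`
and every answer `d` violates the next bound `δ'`, as witnessed by `φ_d`, whose value at `c` is
`r_d`. Then `inf_{vₙ} sup_d |φ_d - r_d|` is an `Ω`-formula with value `0` in `A` and at least `δ'`
in `B`, contradicting agreement up to `δ < δ'` (`OmegaClose.exists_update`). Passing to an infimum
loses the strict inequality, so the error bounds must strictly increase. -/

theorem Term.eval_congr (A : MetricStructure σ) {s t : ℕ → A} :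
    ∀ T : Term σ, (∀ i ∈ T.vars, s i = t i) → T.eval A s = T.eval A t
  | .var i, h => h i rfl
  | .const _, _ => rfl
  | .app f ts, h => by
    simp only [Term.eval]
    congr 1
    funext j
    exact Term.eval_congr A (ts j) fun i hi => h i (Set.mem_iUnion.2 ⟨j, hi⟩)

namespace Formula

theorem eval_congr (A : MetricStructure σ) (φ : Formula σ) :
    ∀ {s t : ℕ → A}, (∀ i ∈ φ.freeVars, s i = t i) → φ.eval A s = φ.eval A t := by
  have update_congr : ∀ {ψ : Formula σ} {i : ℕ} {s t : ℕ → A},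
      (∀ j ∈ ψ.freeVars \ {i}, s j = t j) → ∀ c : A, ∀ j ∈ ψ.freeVars,
        Function.update s i c j = Function.update t i c j := by
    intro ψ i s t h c j hj
    by_cases hji : j = i
    · subst hji; simp
    · simpa [hji] using h j ⟨hj, hji⟩
  induction φ with
  | distAtom T T' =>
    intro s t h
    simp only [eval, Term.eval_congr A T fun i hi => h i (Or.inl hi),
      Term.eval_congr A T' fun i hi => h i (Or.inr hi)]
  | pred P ts =>
    intro s t h
    simp only [eval]
    congr 1
    funext j
    exact Term.eval_congr A (ts j) fun i hi => h i (Set.mem_iUnion.2 ⟨j, hi⟩)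
  | conn c φ ih =>
    intro s t h
    simp only [eval]
    congr 1
    funext j
    exact ih j fun i hi => h i (Set.mem_iUnion.2 ⟨j, hi⟩)
  | supVar i φ ih =>
    intro s t h
    exact iSup_congr fun c => ih (update_congr h c)
  | infVar i φ ih =>
    intro s t h
    exact iInf_congr fun c => ih (update_congr h c)
  | supFam φ ih =>
    intro s t h
    exact iSup_congr fun j => ih j fun i hi => h i (Set.mem_iUnion.2 ⟨j, hi⟩)
  | infFam φ ih =>
    intro s t h
    exact iInf_congr fun j => ih j fun i hi => h i (Set.mem_iUnion.2 ⟨j, hi⟩)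

theorem IsOmega.freeVars_subset {Ω : WeakModulus} {n : ℕ} {φ : Formula σ} (h : IsOmega Ω n φ) :
    φ.freeVars ⊆ Set.Iio n := by
  have diff_subset : ∀ {m : ℕ} {S : Set ℕ}, S ⊆ Set.Iio (m + 1) → S \ {m} ⊆ Set.Iio m :=
    fun hS i hi => lt_of_le_of_ne (Nat.lt_succ_iff.1 (hS hi.1)) hi.2
  induction h with
  | basic h => exact h.2.1
  | supVar _ ih => exact diff_subset ih
  | infVar _ ih => exact diff_subset ih
  | supFam _ ih => exact Set.iUnion_subset ih
  | infFam _ ih => exact Set.iUnion_subset ih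
  | conn _ _ ih => exact Set.iUnion_subset ih

theorem IsOmega.eval_congr {Ω : WeakModulus} {n : ℕ} {φ : Formula σ} (h : IsOmega Ω n φ)
    (A : MetricStructure σ) {s t : ℕ → A} (hst : ∀ i < n, s i = t i) :
    φ.eval A s = φ.eval A t :=
  Formula.eval_congr A φ fun i hi => hst i (h.freeVars_subset hi)

end Formula

/-! ### Suprema and infima in the unit interval -/

theorem coe_iSup_le_add {X Y : Type*} {f : X → unitInterval} {g : Y → unitInterval} {ε : ℝ}
    (hε : 0 ≤ ε) (h : ∀ x, ∃ y, (f x : ℝ) ≤ g y + ε) :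
    ((⨆ x, f x : unitInterval) : ℝ) ≤ (⨆ y, g y : unitInterval) + ε := by
  -- The bound is truncated at 1 to make it a point of `[0,1]`, where the supremum is taken. That it
  -- is at least 0 uses only `hε`, so empty index sets are covered.
  have key : (⨆ x, f x) ≤
      (⟨min 1 ((⨆ y, g y : unitInterval) + ε), le_min zero_le_one
        (add_nonneg (unitInterval.nonneg _) hε), min_le_left _ _⟩ : unitInterval) := by
    refine iSup_le fun x => ?_
    obtain ⟨y, hy⟩ := h x
    have hg : (g y : ℝ) ≤ (⨆ y, g y : unitInterval) := Subtype.coe_le_coe.2 (le_iSup g y)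
    exact Subtype.coe_le_coe.1 (le_min (unitInterval.le_one _) (by linarith))
  exact (Subtype.coe_le_coe.2 key).trans (min_le_right _ _)

theorem coe_iInf_le_add {X Y : Type*} {f : X → unitInterval} {g : Y → unitInterval} {ε : ℝ}
    (hε : 0 ≤ ε) (h : ∀ y, ∃ x, (f x : ℝ) ≤ g y + ε) :
    ((⨅ x, f x : unitInterval) : ℝ) ≤ (⨅ y, g y : unitInterval) + ε := by
  have key : (⟨max 0 ((⨅ x, f x : unitInterval) - ε), le_max_left _ _, max_le zero_le_one
        (by linarith [unitInterval.le_one (⨅ x, f x)])⟩ : unitInterval) ≤ ⨅ y, g y := by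
    refine le_iInf fun y => ?_
    obtain ⟨x, hx⟩ := h y
    have hf : ((⨅ x, f x : unitInterval) : ℝ) ≤ f x := Subtype.coe_le_coe.2 (iInf_le f x)
    exact Subtype.coe_le_coe.1 (max_le (unitInterval.nonneg _) (by linarith))
  linarith [(le_max_right _ _).trans (Subtype.coe_le_coe.2 key)]

/-- The index sets differ because a quantifier ranges over `A` on one side and over `B` on the
other; the two matching hypotheses are the back-and-forth condition. -/
theorem abs_iSup_sub_iSup_le {X Y : Type*} {f : X → unitInterval} {g : Y → unitInterval} {ε : ℝ}
    (hε : 0 ≤ ε) (hf : ∀ x, ∃ y, |(f x : ℝ) - g y| ≤ ε) (hg : ∀ y, ∃ x, |(f x : ℝ) - g y| ≤ ε) :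
    |((⨆ x, f x : unitInterval) : ℝ) - (⨆ y, g y : unitInterval)| ≤ ε := by
  have h₁ := coe_iSup_le_add (f := f) (g := g) hε fun x => (hf x).imp fun y hy => by linarith [(abs_le.1 hy).2]
  have h₂ := coe_iSup_le_add (f := g) (g := f) hε fun y => (hg y).imp fun x hx => by linarith [(abs_le.1 hx).1]
  exact abs_le.2 ⟨by linarith, by linarith⟩

theorem abs_iInf_sub_iInf_le {X Y : Type*} {f : X → unitInterval} {g : Y → unitInterval} {ε : ℝ}
    (hε : 0 ≤ ε) (hf : ∀ x, ∃ y, |(f x : ℝ) - g y| ≤ ε) (hg : ∀ y, ∃ x, |(f x : ℝ) - g y| ≤ ε) :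
    |((⨅ x, f x : unitInterval) : ℝ) - (⨅ y, g y : unitInterval)| ≤ ε := by
  have h₁ := coe_iInf_le_add (f := f) (g := g) hε fun y => (hg y).imp fun x hx => by linarith [(abs_le.1 hx).2]
  have h₂ := coe_iInf_le_add (f := g) (g := f) hε fun x => (hf x).imp fun y hy => by linarith [(abs_le.1 hy).1]
  exact abs_le.2 ⟨by linarith, by linarith⟩

/-! ### From winning strategies to equivalence -/

theorem RoundResult.unique {A B : Type u} {x y : A ⊕ B} {a a' : A} {b b' : B}
    (h : RoundResult x y a b) (h' : RoundResult x y a' b') : a = a' ∧ b = b' := by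
  rcases h with ⟨rfl, rfl⟩ | ⟨rfl, rfl⟩ <;> rcases h' with ⟨h₁, h₂⟩ | ⟨h₁, h₂⟩ <;> simp_all

/-- If a strategy wins every play for `ε`, then at any position with `n` completed rounds reached
by it all `n`-ary `Ω`-formulae agree up to `ε`. -/
theorem Formula.IsOmega.abs_eval_sub_eval_le {Ω : WeakModulus} {A B : MetricStructure σ} {ε : ℝ}
    (hε : 0 ≤ ε) {τ : (i : ℕ) → (Fin (i + 1) → A ⊕ B) → A ⊕ B}
    (hτ : ∀ x : ℕ → A ⊕ B, IIWinsPlay Ω A B ε x fun i => τ i fun j => x j)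
    {n : ℕ} {φ : Formula σ} (hφ : IsOmega Ω n φ) :
    ∀ (x : ℕ → A ⊕ B) (a : ℕ → A) (b : ℕ → B),
      (∀ i < n, RoundResult (x i) (τ i fun j => x j) (a i) (b i)) →
      |(φ.eval A a : ℝ) - φ.eval B b| ≤ ε := by
  -- Changing I's move in round `m` to `z` leaves the earlier answers of II intact, since the
  -- strategy only sees moves up to the current round. So any position continues by a round in which
  -- I plays `z`.
  have extend : ∀ {m : ℕ} (x : ℕ → A ⊕ B) (a : ℕ → A) (b : ℕ → B),
      (∀ i < m, RoundResult (x i) (τ i fun j => x j) (a i) (b i)) →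
      ∀ z : A ⊕ B, ∃ (x' : ℕ → A ⊕ B) (c : A) (d : B), (z = Sum.inl c ∨ z = Sum.inr d) ∧
        ∀ i < m + 1, RoundResult (x' i) (τ i fun j => x' j)
          (Function.update a m c i) (Function.update b m d i) := by
    intro m x a b h z
    obtain ⟨a', b', hab, -⟩ := hτ (Function.update x m z)
    refine ⟨Function.update x m z, a' m, b' m, ?_, fun i hi => ?_⟩
    · have := hab m
      rw [Function.update_self] at this
      exact this.imp And.left And.left
    · rcases Nat.lt_succ_iff_lt_or_eq.1 hi with hi | rfl
      · have hx : (fun j : Fin (i + 1) => Function.update x m z j) =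
            fun j : Fin (i + 1) => x j :=
          funext fun j => Function.update_of_ne (by have := j.2; omega) _ _
        rw [hx, Function.update_of_ne hi.ne, Function.update_of_ne hi.ne,
          Function.update_of_ne hi.ne]
        exact h i hi
      · simpa using hab i
  induction hφ with
  | @basic n φ h =>
    intro x a b hab
    obtain ⟨a', b', hab', hwin⟩ := hτ x
    have key := hwin n φ h
    rwa [(IsOmega.basic h).eval_congr A fun i hi => ((hab i hi).unique (hab' i)).1,
      (IsOmega.basic h).eval_congr B fun i hi => ((hab i hi).unique (hab' i)).2]
  | supVar _ ih =>
    intro x a b hab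
    refine abs_iSup_sub_iSup_le hε (fun c => ?_) (fun d => ?_)
    · obtain ⟨x', c', d, hz, h⟩ := extend x a b hab (Sum.inl c)
      obtain rfl : c = c' := by simpa using hz
      exact ⟨d, ih x' _ _ h⟩
    · obtain ⟨x', c, d', hz, h⟩ := extend x a b hab (Sum.inr d)
      obtain rfl : d = d' := by simpa using hz
      exact ⟨c, ih x' _ _ h⟩
  | infVar _ ih =>
    intro x a b hab
    refine abs_iInf_sub_iInf_le hε (fun c => ?_) (fun d => ?_)
    · obtain ⟨x', c', d, hz, h⟩ := extend x a b hab (Sum.inl c)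
      obtain rfl : c = c' := by simpa using hz
      exact ⟨d, ih x' _ _ h⟩
    · obtain ⟨x', c, d', hz, h⟩ := extend x a b hab (Sum.inr d)
      obtain rfl : d = d' := by simpa using hz
      exact ⟨c, ih x' _ _ h⟩
  | supFam _ ih =>
    intro x a b hab
    exact abs_iSup_sub_iSup_le hε (fun j => ⟨j, ih j x a b hab⟩) fun j => ⟨j, ih j x a b hab⟩
  | infFam _ ih =>
    intro x a b hab
    exact abs_iInf_sub_iInf_le hε (fun j => ⟨j, ih j x a b hab⟩) fun j => ⟨j, ih j x a b hab⟩
  | @conn n k c φ hc _ ih =>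
    intro x a b hab
    have h := hc.dist_le_mul (fun j => (φ j).eval A a) (fun j => (φ j).eval B b)
    rw [NNReal.coe_one, one_mul] at h
    exact h.trans ((dist_pi_le_iff hε).2 fun j => ih j x a b hab)

theorem IIWinsEF.omegaEquivInf {Ω : WeakModulus} {A B : MetricStructure σ}
    (h : IIWinsEF Ω A B) : OmegaEquivInf Ω A B := by
  obtain ⟨τ, hτ⟩ := h
  rintro α φ ⟨⟨n, hφ⟩, hfree⟩ - s t
  have key : ∀ ε : ℝ, 0 < ε → |(φ.eval A s : ℝ) - φ.eval B t| ≤ ε := by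
    intro ε hε
    -- Any play would do: `φ` has no free variables, but its arity `n` may be positive, so some
    -- position of length `n` is needed.
    obtain ⟨a, b, hab, -⟩ := hτ ε hε fun i => Sum.inl (s i)
    have h := hφ.abs_eval_sub_eval_le hε.le (hτ ε hε) _ a b fun i _ => hab i
    rwa [Formula.eval_congr A φ (s := a) (t := s) (by simp [hfree]),
      Formula.eval_congr B φ (s := b) (t := t) (by simp [hfree])] at h
  exact Subtype.ext (sub_eq_zero.1 (abs_nonpos_iff.1
    (le_of_forall_pos_le_add fun ε hε => by simpa using key ε hε)))

/-! ### From equivalence to winning strategies -/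

/-- All `n`-ary `Ω`-formulae agree at `s` and `t` up to `δ`. -/
def OmegaClose (Ω : WeakModulus) (A B : MetricStructure σ) (δ : ℝ) (n : ℕ)
    (s : ℕ → A) (t : ℕ → B) : Prop :=
  ∀ φ : Formula σ, φ.IsOmega Ω n → |(φ.eval A s : ℝ) - φ.eval B t| ≤ δ

theorem OmegaClose.symm {Ω : WeakModulus} {A B : MetricStructure σ} {δ : ℝ} {n : ℕ}
    {s : ℕ → A} {t : ℕ → B} (h : OmegaClose Ω A B δ n s t) : OmegaClose Ω B A δ n t s :=
  fun φ hφ => abs_sub_comm (φ.eval A s : ℝ) _ ▸ h φ hφ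

/-- The unary connective `x ↦ |x - r|`. -/
noncomputable def distConnective (r : unitInterval) : Connective 1 where
  toFun v := ⟨dist (v 0) r, dist_nonneg, Real.dist_le_of_mem_Icc_01 (v 0).2 r.2⟩
  continuous_toFun := by fun_prop

theorem lipschitzWith_distConnective (r : unitInterval) : LipschitzWith 1 (distConnective r) := by
  refine LipschitzWith.of_dist_le_mul fun v w => ?_
  rw [NNReal.coe_one, one_mul]
  exact (abs_dist_sub_le (v 0) (w 0) r).trans (dist_le_pi_dist v w 0)

/-- If every `d` fails, the failures are collected into one `Ω`-formula by a supremum indexed by the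
elements of `B`. Recentring each witness at its value in `A` is 1-Lipschitz, hence an admissible
connective. -/
theorem OmegaClose.exists_update {Ω : WeakModulus} {A B : MetricStructure σ} {δ δ' : ℝ} {n : ℕ}
    {s : ℕ → A} {t : ℕ → B} (h : OmegaClose Ω A B δ n s t) (hδ' : 0 ≤ δ') (hδ : δ < δ') (c : A) :
    ∃ d : B, OmegaClose Ω A B δ' (n + 1) (Function.update s n c) (Function.update t n d) := by
  by_contra! hne
  simp only [OmegaClose, not_forall, not_le] at hne
  choose φ hφ hlt using hne
  let ψ : B → Formula σ := fun d =>
    .conn (distConnective ((φ d).eval A (Function.update s n c))) fun _ => φ d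
  have hψ : ∀ d, (ψ d).IsOmega Ω (n + 1) := fun d =>
    .conn (lipschitzWith_distConnective _) fun _ => hφ d
  -- The element `c` makes all constituents vanish at once.
  have hA : (Formula.infVar n (.supFam ψ)).eval A s = 0 := by
    refine le_antisymm ((iInf_le _ c).trans (iSup_le fun d => ?_)) bot_le
    exact Subtype.coe_le_coe.1 (dist_self ((φ d).eval A (Function.update s n c))).le
  -- A difference of two values in `[0,1]` exceeds `δ'`; such a difference exists because `B` is
  -- non-empty.
  have hδ₁ : δ' ≤ 1 := by
    obtain ⟨d⟩ := B.nonempty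
    exact (hlt d).le.trans (Real.dist_le_of_mem_Icc_01 (Subtype.mem _) (Subtype.mem _))
  -- For the value `d` of `vₙ`, the constituent `ψ d` alone already exceeds `δ'`.
  have hB : (⟨δ', hδ', hδ₁⟩ : unitInterval) ≤ (Formula.infVar n (.supFam ψ)).eval B t := by
    refine le_iInf fun d => le_iSup_of_le d (Subtype.coe_le_coe.1 ?_)
    exact (hlt d).le.trans_eq (abs_sub_comm _ _)
  have hle := h _ (.infVar (.supFam hψ))
  rw [hA, abs_sub_comm] at hle
  have := (le_abs_self _).trans hle
  have hB' : δ' ≤ _ := Subtype.coe_le_coe.2 hB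
  simp only [Set.Icc.coe_zero, sub_zero] at this
  linarith

/-- One round of the back-and-forth: whatever player I plays, player II has an answer that keeps
the `Ω`-formulae close. -/
theorem OmegaClose.exists_round {Ω : WeakModulus} {A B : MetricStructure σ} {δ δ' : ℝ} {n : ℕ}
    {s : ℕ → A} {t : ℕ → B} (h : OmegaClose Ω A B δ n s t) (hδ' : 0 ≤ δ') (hδ : δ < δ')
    (x : A ⊕ B) : ∃ (c : A) (d : B) (y : A ⊕ B), RoundResult x y c d ∧
      OmegaClose Ω A B δ' (n + 1) (Function.update s n c) (Function.update t n d) := by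
  rcases x with c | d
  · obtain ⟨d, hd⟩ := h.exists_update hδ' hδ c
    exact ⟨c, d, Sum.inr d, Or.inl ⟨rfl, rfl⟩, hd⟩
  · obtain ⟨c, hc⟩ := h.symm.exists_update hδ' hδ d
    exact ⟨c, d, Sum.inl c, Or.inr ⟨rfl, rfl⟩, hc.symm⟩

/-- The error allowed after `n` rounds. -/
noncomputable def roundError (ε : ℝ) (n : ℕ) : ℝ := ε * (1 - (1 / 2) ^ n)

theorem roundError_nonneg {ε : ℝ} (hε : 0 ≤ ε) (n : ℕ) : 0 ≤ roundError ε n :=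
  mul_nonneg hε (sub_nonneg.2 (pow_le_one₀ (by norm_num) (by norm_num)))

theorem roundError_lt_succ {ε : ℝ} (hε : 0 < ε) (n : ℕ) : roundError ε n < roundError ε (n + 1) :=
  mul_lt_mul_of_pos_left
    (sub_lt_sub_left (pow_lt_pow_right_of_lt_one₀ (by norm_num) (by norm_num) n.lt_succ_self) _) hε

theorem roundError_le {ε : ℝ} (hε : 0 ≤ ε) (n : ℕ) : roundError ε n ≤ ε :=
  mul_le_of_le_one_right hε (sub_le_self _ (by positivity))

/-- The result `(c, d)` of round `n` and the move of II, at a position `(s, t)` where I plays `x`,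
if II keeps the `Ω`-formulae as close as she can. -/
theorem exists_response (Ω : WeakModulus) (A B : MetricStructure σ) (ε : ℝ) (n : ℕ)
    (p : (ℕ → A) × (ℕ → B)) (x : A ⊕ B) :
    ∃ r : A × B × (A ⊕ B), 0 < ε → OmegaClose Ω A B (roundError ε n) n p.1 p.2 →
      RoundResult x r.2.2 r.1 r.2.1 ∧ OmegaClose Ω A B (roundError ε (n + 1)) (n + 1)
        (Function.update p.1 n r.1) (Function.update p.2 n r.2.1) := by
  by_cases h : 0 < ε ∧ OmegaClose Ω A B (roundError ε n) n p.1 p.2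
  · obtain ⟨c, d, y, hy⟩ :=
      h.2.exists_round (roundError_nonneg h.1.le _) (roundError_lt_succ h.1 n) x
    exact ⟨(c, d, y), fun _ _ => hy⟩
  -- An arbitrary value for positions where the invariant fails; it makes the response a total
  -- function.
  · exact ⟨(p.1 0, p.2 0, x), fun h₁ h₂ => (h ⟨h₁, h₂⟩).elim⟩

/-- The response to the move `x` in round `n` at position `p`. -/
noncomputable def response (Ω : WeakModulus) (A B : MetricStructure σ) (ε : ℝ) (n : ℕ)
    (p : (ℕ → A) × (ℕ → B)) (x : A ⊕ B) : A × B × (A ⊕ B) :=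
  (exists_response Ω A B ε n p x).choose

/-- The position after `n` rounds in which I plays according to `x`. -/
noncomputable def position (Ω : WeakModulus) (A B : MetricStructure σ) (ε : ℝ) (x : ℕ → A ⊕ B) :
    ℕ → (ℕ → A) × (ℕ → B)
  | 0 => (fun _ => Classical.choice A.nonempty, fun _ => Classical.choice B.nonempty)
  | n + 1 =>
    let p := position Ω A B ε x n
    let r := response Ω A B ε n p (x n)
    (Function.update p.1 n r.1, Function.update p.2 n r.2.1)

/-- The position after `n` rounds depends only on I's moves before round `n`. This lets II compute
it from what she has seen. -/
theorem position_congr (Ω : WeakModulus) (A B : MetricStructure σ) (ε : ℝ) {x x' : ℕ → A ⊕ B} :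
    ∀ {n : ℕ}, (∀ i < n, x i = x' i) → position Ω A B ε x n = position Ω A B ε x' n
  | 0, _ => rfl
  | n + 1, h => by
    simp only [position, position_congr Ω A B ε fun i (hi : i < n) => h i (hi.trans n.lt_succ_self),
      h n n.lt_succ_self]

/-- Round `n` changes only the entry with index `n`, so entry `i` is final once round `i` is over.
The finite positions therefore fit together into the two sequences of the infinite play. -/
theorem position_stable (Ω : WeakModulus) (A B : MetricStructure σ) (ε : ℝ) (x : ℕ → A ⊕ B)
    {i n : ℕ} (h : i < n) :
    (position Ω A B ε x n).1 i = (response Ω A B ε i (position Ω A B ε x i) (x i)).1 ∧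
      (position Ω A B ε x n).2 i = (response Ω A B ε i (position Ω A B ε x i) (x i)).2.1 := by
  induction n, h using Nat.le_induction with
  | base => simp [position]
  | succ n hn ih =>
    have hne : i ≠ n := (Nat.lt_of_succ_le hn).ne
    simpa [position, hne] using ih

theorem omegaClose_position {Ω : WeakModulus} {A B : MetricStructure σ}
    (h : OmegaEquivInf Ω A B) {ε : ℝ} (hε : 0 < ε) (x : ℕ → A ⊕ B) (n : ℕ) :
    OmegaClose Ω A B (roundError ε n) n (position Ω A B ε x n).1 (position Ω A B ε x n).2 := by
  induction n with
  | zero =>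
    intro φ hφ
    have hfree : φ.freeVars = ∅ :=
      Set.eq_empty_of_forall_notMem fun i hi => Nat.not_lt_zero i (hφ.freeVars_subset hi)
    -- The equivalence holds at every ordinal, so it may be used at the rank of `φ` itself.
    rw [h φ.qr φ ⟨⟨0, hφ⟩, hfree⟩ le_rfl _ (position Ω A B ε x 0).2, sub_self, abs_zero]
    exact roundError_nonneg hε.le 0
  | succ n ih => exact ((exists_response Ω A B ε n _ (x n)).choose_spec hε ih).2

theorem OmegaEquivInf.iiWinsEF {Ω : WeakModulus} {A B : MetricStructure σ}
    (h : OmegaEquivInf Ω A B) : IIWinsEF Ω A B := by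
  -- The moves seen so far are prolonged to an infinite sequence by reduction modulo `i + 1`. Only
  -- the entries below `i` affect the position, and these are the true moves.
  let ext (i : ℕ) (x : Fin (i + 1) → A ⊕ B) (j : ℕ) : A ⊕ B := x (Fin.ofNat (i + 1) j)
  refine ⟨fun ε i x => (response Ω A B ε i (position Ω A B ε (ext i x) i) (x (Fin.last i))).2.2,
    fun ε hε x => ?_⟩
  refine ⟨fun i => (response Ω A B ε i (position Ω A B ε x i) (x i)).1,
    fun i => (response Ω A B ε i (position Ω A B ε x i) (x i)).2.1, fun i => ?_, ?_⟩
  · have hpos : position Ω A B ε (ext i fun j => x j) i = position Ω A B ε x i :=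
      position_congr Ω A B ε fun j hj => by
        simp [ext, Nat.mod_eq_of_lt (hj.trans i.lt_succ_self)]
    simp only [hpos, Fin.val_last]
    exact ((exists_response Ω A B ε i _ (x i)).choose_spec hε (omegaClose_position h hε x i)).1
  · intro k φ hφ
    have hclose := omegaClose_position h hε x k φ (.basic hφ)
    rw [(Formula.IsOmega.basic hφ).eval_congr A fun i hi => (position_stable Ω A B ε x hi).1,
      (Formula.IsOmega.basic hφ).eval_congr B fun i hi => (position_stable Ω A B ε x hi).2]
      at hclose
    exact hclose.trans (roundError_le hε.le k)

end ContLogic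

theorem mainTheorem8 (σ : ContLogic.Signature.{u}) (Ω : ContLogic.WeakModulus)
    (A B : ContLogic.MetricStructure σ) :
    ContLogic.IIWinsEF Ω A B ↔ ContLogic.OmegaEquivInf Ω A B :=
  ⟨ContLogic.IIWinsEF.omegaEquivInf, ContLogic.OmegaEquivInf.iiWinsEF⟩
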